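/- Let $1\le p\le\infty$ and $\frac1p+\frac1q=1$. For a Banach space $E$ (real or complex), let $\ell_p^s(E)$ be the space of sequences $y=(y_n)$ in $E$ with $\|y\|_p=\big(\sum_n\|y_n\|^p\big)^{1/p}<\infty$ if $p<\infty$; if $p=\infty$, use instead the space of norm-null sequences, with $\|y\|_\infty=\sup_n\|y_n\|$. For such $y$ put $E_y(\alpha)=\sum_n\alpha_n y_n$ for $\alpha\in\ell_q$. A bounded linear operator $R:E\to F$ between Banach spaces is called $p$-compact if $R(B_E)\subseteq E_y(B_{\ell_q})$ for some such sequence $y$ in $F$, and $\kappa_p(R)$ is the infimum of $\|y\|_p$ over all such $y$. Let $K_p^d(E,F)$ be the set of all bounded linear operators $R:E\to F$ whose adjoint $R^*:F^*\to E^*$ is $p$-compact, with $\kappa_p^d(R)=\kappa_p(R^*)$. **Theorem.** Let $X,Y,Z$ be Banach spaces over the same scalar field with $Z\supseteq X$ (isometrically), let $T\in K_p^d(X,Y)$ and $\varepsilon>0$. Regard $Y$ as a subspace of $\ell_\infty(B_{Y^*})$ through the canonical isometric embedding $\iota_Y(y)=(f(y))_{f\in B_{Y^*}}$. Then there is an operator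 $\widetilde T\in K_p^d(Z,\ell_\infty(B_{Y^*}))$ which extends $T$, that is, $\widetilde T x=\iota_Y(Tx)$ for all $x\in X$, and which satisfies $\kappa_p^d(\widetilde T)\le\kappa_p^d(T)+\varepsilon$. -/

import Mathlib

open scoped ENNReal Topology

noncomputable section

/-- `E_y(B_{ℓ_q})`: the set of all sums `∑ αₙ yₙ` with `(αₙ)` in the closed unit ball of `ℓ_q`. -/
def seqBallImage (𝕜 : Type*) [RCLike 𝕜] {E : Type*} [NormedAddCommGroup E] [NormedSpace 𝕜 E]
    (q : ℝ≥0∞) (y : ℕ → E) : Set E :=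
  {z | ∃ a : lp (fun _ : ℕ => 𝕜) q, ‖a‖ ≤ 1 ∧ HasSum (fun n => a n • y n) z}

/-- The sequences used to define `p`-compactness: `ℓ_p^s(E)` for `p < ∞`, and the norm-null
sequences `c_0^s(E)` for `p = ∞`. They carry the norm of `lp (fun _ : ℕ => E) p`, which is
`(∑ ‖yₙ‖^p)^(1/p)` for `1 ≤ p < ∞` and `sup ‖yₙ‖` for `p = ∞`. -/
def strongSeq (E : Type*) [NormedAddCommGroup E] (p : ℝ≥0∞) : Set (lp (fun _ : ℕ => E) p) :=
  {y | p = ∞ → Filter.Tendsto (fun n => y n) Filter.atTop (𝓝 0)}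

/-- A set `K` is relatively `p`-compact if `K ⊆ E_y(B_{ℓ_q})`, `1/p + 1/q = 1`, for some `y` in
`ℓ_p^s(E)` (in `c_0^s(E)` if `p = ∞`). -/
def IsRelPCompact (𝕜 : Type*) [RCLike 𝕜] {E : Type*} [NormedAddCommGroup E] [NormedSpace 𝕜 E]
    (p : ℝ≥0∞) (K : Set E) : Prop :=
  ∃ y ∈ strongSeq E p, K ⊆ seqBallImage 𝕜 p.conjExponent (fun n => y n)

section Operators

variable {𝕜 : Type*} [RCLike 𝕜] {E F : Type*}
  [NormedAddCommGroup E] [NormedSpace 𝕜 E] [NormedAddCommGroup F] [NormedSpace 𝕜 F]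

/-- `T ∈ K_p(E, F)`: the image of the closed unit ball is relatively `p`-compact. -/
def IsPCompactOp (p : ℝ≥0∞) (T : E →L[𝕜] F) : Prop :=
  IsRelPCompact 𝕜 p (T '' Metric.closedBall 0 1)

/-- `κ_p(T) = inf {‖y‖_p : T(B_E) ⊆ E_y(B_{ℓ_q})}`. -/
def kappa (p : ℝ≥0∞) (T : E →L[𝕜] F) : ℝ :=
  sInf {r : ℝ | ∃ y ∈ strongSeq F p,
    T '' Metric.closedBall 0 1 ⊆ seqBallImage 𝕜 p.conjExponent (fun n => y n) ∧ r = ‖y‖}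

/-- The Banach space adjoint `T* : F* → E*`, `T* f = f ∘ T`. -/
def banachAdjoint (T : E →L[𝕜] F) : StrongDual 𝕜 F →L[𝕜] StrongDual 𝕜 E :=
  ContinuousLinearMap.precomp 𝕜 T

/-- `T ∈ K_p^d(E, F)`, the dual ideal of `K_p`: the adjoint of `T` is `p`-compact. -/
def IsDualPCompactOp (p : ℝ≥0∞) (T : E →L[𝕜] F) : Prop :=
  IsPCompactOp p (banachAdjoint T)

/-- `κ_p^d(T) = κ_p(T*)`. -/
def kappaDual (p : ℝ≥0∞) (T : E →L[𝕜] F) : ℝ :=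
  kappa p (banachAdjoint T)

end Operators

section Embedding

variable (𝕜 : Type*) [RCLike 𝕜] (Y : Type*) [NormedAddCommGroup Y] [NormedSpace 𝕜 Y]

/-- `ℓ_∞(B_{Y*})`: bounded scalar functions on the closed unit ball of `Y*`, sup norm. -/
abbrev LinftyDualBall : Type _ :=
  lp (fun _ : Metric.closedBall (0 : StrongDual 𝕜 Y) 1 => 𝕜) ∞

variable {Y}

theorem norm_dualBall_apply_le (y : Y) (f : Metric.closedBall (0 : StrongDual 𝕜 Y) 1) :
    ‖f.1 y‖ ≤ ‖y‖ := by
  have hf : ‖f.1‖ ≤ 1 := mem_closedBall_zero_iff.mp f.2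
  calc ‖f.1 y‖ ≤ ‖f.1‖ * ‖y‖ := f.1.le_opNorm y
    _ ≤ 1 * ‖y‖ := by gcongr
    _ = ‖y‖ := one_mul _

theorem memlp_dualBall (y : Y) :
    Memℓp (fun f : Metric.closedBall (0 : StrongDual 𝕜 Y) 1 => f.1 y) ∞ := by
  refine memℓp_infty ⟨‖y‖, ?_⟩
  rintro _ ⟨f, rfl⟩
  exact norm_dualBall_apply_le 𝕜 y f

variable (Y)

/-- The canonical isometric embedding `Y → ℓ_∞(B_{Y*})`, `y ↦ (f(y))_f`. -/
def canonicalEmbedding : Y →ₗᵢ[𝕜] LinftyDualBall 𝕜 Y where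
  toFun y := ⟨fun f => f.1 y, memlp_dualBall 𝕜 y⟩
  map_add' x y := by
    ext f
    exact map_add f.1 x y
  map_smul' c y := by
    ext f
    exact map_smul f.1 c y
  norm_map' y := by
    apply le_antisymm
    · exact lp.norm_le_of_forall_le (norm_nonneg y) (fun f => norm_dualBall_apply_le 𝕜 y f)
    · obtain ⟨g, hg, hgy⟩ := exists_dual_vector'' 𝕜 y
      have h := lp.norm_apply_le_norm (p := ∞) (by simp)
        (⟨fun f => f.1 y, memlp_dualBall 𝕜 y⟩ : LinftyDualBall 𝕜 Y) ⟨g, by simpa using hg⟩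
      simpa [hgy] using h

end Embedding

end

/-!
Choose `y` in `ℓ_p^s(X*)` with `T*(B_{Y*}) ⊆ E_y(B_{ℓ_q})` and `‖y‖_p` within `ε` of `κ_p(T*)`, and
let `zₙ ∈ Z*` be norm-preserving Hahn–Banach extensions of the functionals `yₙ ∈ X*`. For every `f`
in the ball of `Y*` there is `a^f` in the ball of `ℓ_q` with `f ∘ T = ∑ a^f_n yₙ`, and the extension
of `T` is `(T' w)(f) = ∑ a^f_n zₙ(w)`.

By construction `T' = A ∘ S`, where `S w = (zₙ(w))ₙ` takes values in `ℓ_p` (in `c₀` if `p = ∞`) and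
`A : ℓ_p → ℓ_∞(B_{Y*})`, `(A b)(f) = ∑ a^f_n bₙ`, is a contraction by Hölder's inequality. If `μ` is
in the unit ball of the dual of `ℓ_∞(B_{Y*})`, then `μ ∘ A` is a functional of norm at most `1` on
`ℓ_p`, so its values `cₙ` on the unit vectors form a sequence in the ball of `ℓ_q`
(`lp.norm_dualCoeff_le`) and represent it on the closed span of these vectors
(`lp.hasSum_dualCoeff`). Hence `T'* μ = ∑ cₙ zₙ`, so that `z`, which has the norm of `y`, witnesses
that `T'*` is `p`-compact with `κ_p(T'*) ≤ ‖y‖_p`.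
-/

open scoped ENNReal NNReal Topology

/-! ### Duality between `ℓ_p` and `ℓ_q` -/

namespace lp

variable {𝕜 : Type*} [RCLike 𝕜] {p q : ℝ≥0∞}
variable {E : Type*} [NormedAddCommGroup E] [NormedSpace 𝕜 E]

theorem summable_smul [q.HolderConjugate p] [CompleteSpace E] (a : lp (fun _ : ℕ => 𝕜) q)
    (y : lp (fun _ : ℕ => E) p) : Summable fun n => a n • y n :=
  ((lp.memℓp a).holder 1 (lp.memℓp y) (fun _ => ContinuousLinearMap.lsmul 𝕜 𝕜) (K := 1)
    fun _ => ContinuousLinearMap.opNorm_lsmul_le).summable_of_one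

variable [Fact (1 ≤ p)]

theorem apply_single_eq_mul (φ : StrongDual 𝕜 (lp (fun _ : ℕ => 𝕜) p)) (n : ℕ) (t : 𝕜) :
    φ (lp.single p n t) = t * φ (lp.single p n 1) := by
  rw [← smul_eq_mul (a := t), ← map_smul, ← lp.single_smul, smul_eq_mul, mul_one]

theorem norm_apply_single_one_le (φ : StrongDual 𝕜 (lp (fun _ : ℕ => 𝕜) p)) (hφ : ‖φ‖ ≤ 1)
    (n : ℕ) : ‖φ (lp.single p n 1)‖ ≤ 1 := by
  refine (φ.le_of_opNorm_le hφ _).trans ?_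
  rw [lp.norm_single (zero_lt_one.trans_le Fact.out)]
  simp

/-- The functional is tested on the sequence `bₙ = gₙ · conj(cₙ) / |cₙ|` over `s`, where
`cₙ = φ(eₙ)`; this makes every term `bₙ cₙ` equal to `|cₙ| gₙ`. -/
theorem sum_norm_apply_single_mul_le (φ : StrongDual 𝕜 (lp (fun _ : ℕ => 𝕜) p)) (s : Finset ℕ)
    (g : ℕ → ℝ) {C : ℝ}
    (hC : ∀ b : ℕ → 𝕜, (∀ n, ‖b n‖ ≤ |g n|) → ‖∑ n ∈ s, lp.single p n (b n)‖ ≤ C) :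
    ∑ n ∈ s, ‖φ (lp.single p n 1)‖ * g n ≤ ‖φ‖ * C := by
  set c : ℕ → 𝕜 := fun n => φ (lp.single p n 1)
  set b : ℕ → 𝕜 := fun n => ((g n / ‖c n‖ : ℝ) : 𝕜) * (starRingEnd 𝕜) (c n) with hb
  have hbn (n : ℕ) : ‖b n‖ ≤ |g n| := by
    rw [hb]
    simp only [norm_mul, RCLike.norm_ofReal, RCLike.norm_conj, abs_div, abs_norm]
    rcases eq_or_ne ‖c n‖ 0 with h0 | h0
    · simp [h0]
    · rw [div_mul_cancel₀ _ h0]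
  have hφ : φ (∑ n ∈ s, lp.single p n (b n)) = ((∑ n ∈ s, ‖c n‖ * g n : ℝ) : 𝕜) := by
    rw [map_sum]
    push_cast
    refine Finset.sum_congr rfl fun n _ => ?_
    rw [apply_single_eq_mul]
    change b n * c n = _
    rcases eq_or_ne (c n) 0 with h0 | h0
    · simp [h0]
    · have h2 : (‖c n‖ : 𝕜) ≠ 0 := by simpa using h0
      rw [hb]
      simp only
      rw [mul_assoc, RCLike.conj_mul]
      push_cast
      field_simp
  calc ∑ n ∈ s, ‖c n‖ * g n ≤ ‖((∑ n ∈ s, ‖c n‖ * g n : ℝ) : 𝕜)‖ := by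
        rw [RCLike.norm_ofReal]; exact le_abs_self _
    _ = ‖φ (∑ n ∈ s, lp.single p n (b n))‖ := by rw [hφ]
    _ ≤ ‖φ‖ * ‖∑ n ∈ s, lp.single p n (b n)‖ := φ.le_opNorm _
    _ ≤ ‖φ‖ * C := by gcongr; exact hC b hbn

/-- The nontrivial half of the duality of `ℓ_p` and `ℓ_q`: the values on the unit vectors of a
functional of norm at most `1` are in the unit ball of `ℓ_q`. -/
theorem sum_norm_apply_single_rpow_le [p.HolderConjugate q] (hq : q ≠ ∞)
    (φ : StrongDual 𝕜 (lp (fun _ : ℕ => 𝕜) p)) (hφ : ‖φ‖ ≤ 1) (s : Finset ℕ) :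
    ∑ n ∈ s, ‖φ (lp.single p n 1)‖ ^ q.toReal ≤ 1 := by
  rcases eq_or_ne p ∞ with rfl | hp
  · obtain rfl : q = 1 := ENNReal.HolderTriple.unique_of_ne_zero (r := 1) (p := ∞) q 1 one_ne_zero
    -- For `q = 1` the weights `1` recover the `ℓ₁`-norm and stay in the unit ball of `ℓ_∞`.
    have h := sum_norm_apply_single_mul_le φ s (fun _ => 1) (C := 1) fun b hb => by
      refine lp.norm_le_of_forall_le zero_le_one fun n => ?_
      simp only [lp.coeFn_sum, lp.coeFn_single, Finset.sum_apply, Finset.sum_pi_single]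
      split_ifs
      · simpa using hb n
      · simp
    simpa using h.trans (by simpa using hφ)
  · have hpq : p.toReal.HolderConjugate q.toReal :=
      ENNReal.HolderConjugate.toReal_of_ne_top hp hq
    -- Weights `g` in the unit ball of `ℓ_p` for which Hölder's inequality is an equality.
    obtain ⟨g, hg, hgs⟩ :=
      (NNReal.isGreatest_Lp s (fun n => ‖φ (lp.single p n 1)‖₊) hpq.symm).1
    have h := sum_norm_apply_single_mul_le φ s (fun n => g n) (C := 1) fun b hb => by
      rw [← Real.rpow_le_rpow_iff (norm_nonneg _) zero_le_one hpq.pos, Real.one_rpow,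
        lp.norm_sum_single hpq.pos b s]
      calc ∑ n ∈ s, ‖b n‖ ^ p.toReal ≤ ∑ n ∈ s, (g n : ℝ) ^ p.toReal := by
            gcongr with n
            simpa using hb n
        _ ≤ 1 := by exact_mod_cast hg
    have h1 : (∑ n ∈ s, ‖φ (lp.single p n 1)‖₊ ^ q.toReal) ^ (1 / q.toReal) ≤ 1 := by
      rw [← hgs, ← NNReal.coe_le_coe]
      push_cast
      exact h.trans (by simpa using hφ)
    have h2 : ∑ n ∈ s, ‖φ (lp.single p n 1)‖₊ ^ q.toReal ≤ 1 := by
      rwa [one_div, NNReal.rpow_inv_le_iff hpq.symm.pos, NNReal.one_rpow] at h1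
    simpa using NNReal.coe_le_coe.2 h2

/-- The sequence `(φ(eₙ))ₙ` of a functional `φ` of norm at most `1` on `ℓ_p`, as an element of
`ℓ_q`. -/
noncomputable def dualCoeff [p.HolderConjugate q] (φ : StrongDual 𝕜 (lp (fun _ : ℕ => 𝕜) p))
    (hφ : ‖φ‖ ≤ 1) : lp (fun _ : ℕ => 𝕜) q :=
  ⟨fun n => φ (lp.single p n 1), by
    rcases eq_or_ne q ∞ with rfl | hq
    · refine memℓp_infty ⟨1, ?_⟩
      rintro _ ⟨n, rfl⟩
      exact norm_apply_single_one_le φ hφ n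
    · exact memℓp_gen' (sum_norm_apply_single_rpow_le hq φ hφ)⟩

theorem dualCoeff_apply [p.HolderConjugate q] (φ : StrongDual 𝕜 (lp (fun _ : ℕ => 𝕜) p))
    (hφ : ‖φ‖ ≤ 1) (n : ℕ) : dualCoeff (q := q) φ hφ n = φ (lp.single p n 1) :=
  rfl

theorem norm_dualCoeff_le [p.HolderConjugate q] (φ : StrongDual 𝕜 (lp (fun _ : ℕ => 𝕜) p))
    (hφ : ‖φ‖ ≤ 1) : ‖dualCoeff (q := q) φ hφ‖ ≤ 1 := by
  rcases eq_or_ne q ∞ with rfl | hq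
  · exact lp.norm_le_of_forall_le zero_le_one (norm_apply_single_one_le φ hφ)
  · have hq0 : 0 < q.toReal :=
      ENNReal.toReal_pos (ENNReal.HolderConjugate.ne_zero q p) hq
    refine lp.norm_le_of_forall_sum_le hq0 zero_le_one fun s => ?_
    rw [Real.one_rpow]
    exact sum_norm_apply_single_rpow_le hq φ hφ s

/-- The finite truncations converge in norm, on all of `ℓ_p` if `p < ∞` and on `c₀` if `p = ∞`. -/
theorem hasSum_single_of_mem_strongSeq {b : lp (fun _ : ℕ => E) p} (hb : b ∈ strongSeq E p) :
    HasSum (fun n => lp.single p n (b n)) b := by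
  rcases eq_or_ne p ∞ with rfl | hp
  · have hb' := Metric.tendsto_atTop.1 (hb rfl)
    rw [HasSum, SummationFilter.unconditional_filter, Metric.tendsto_atTop]
    intro ε hε
    obtain ⟨N, hN⟩ := hb' (ε / 2) (half_pos hε)
    refine ⟨Finset.range N, fun s hs => ?_⟩
    rw [dist_comm, dist_eq_norm]
    refine (lp.norm_le_of_forall_le (half_pos hε).le fun n => ?_).trans_lt (half_lt_self hε)
    simp only [lp.coeFn_sub, lp.coeFn_sum, lp.coeFn_single, Pi.sub_apply, Finset.sum_apply,
      Finset.sum_pi_single]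
    split_ifs with hn
    · simpa using (half_pos hε).le
    · have hNn : N ≤ n := by
        by_contra! h
        exact hn (hs (Finset.mem_range.2 h))
      simpa using (hN n hNn).le
  · exact lp.hasSum_single hp b

/-- For `p = ∞` a functional on `ℓ_∞` is represented by its coefficients only on `c₀`; this is why
the sequences of `strongSeq` have to be norm-null in that case. -/
theorem hasSum_dualCoeff [p.HolderConjugate q] (φ : StrongDual 𝕜 (lp (fun _ : ℕ => 𝕜) p))
    (hφ : ‖φ‖ ≤ 1) {b : lp (fun _ : ℕ => 𝕜) p} (hb : b ∈ strongSeq 𝕜 p) :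
    HasSum (fun n => dualCoeff (q := q) φ hφ n * b n) (φ b) := by
  have h (n : ℕ) : dualCoeff (q := q) φ hφ n * b n = φ (lp.single p n (b n)) := by
    rw [dualCoeff_apply, apply_single_eq_mul φ n (b n), mul_comm]
  rw [funext h]
  exact φ.hasSum (hasSum_single_of_mem_strongSeq hb)

/-! ### Operators built from sequences of functionals -/

/-- The functional `b ↦ ∑ aₙ bₙ` on `ℓ_p` given by a sequence `a` in `ℓ_q`. -/
noncomputable def pairing [Fact (1 ≤ q)] [q.HolderConjugate p] (a : lp (fun _ : ℕ => 𝕜) q) :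
    StrongDual 𝕜 (lp (fun _ : ℕ => 𝕜) p) :=
  lp.dualPairing q p (fun _ => ContinuousLinearMap.lsmul 𝕜 𝕜) (K := 1)
    (fun _ => by simp) a

theorem pairing_apply [Fact (1 ≤ q)] [q.HolderConjugate p] (a : lp (fun _ : ℕ => 𝕜) q)
    (b : lp (fun _ : ℕ => 𝕜) p) : pairing a b = ∑' n, a n • b n :=
  rfl

theorem norm_pairing_le [Fact (1 ≤ q)] [q.HolderConjugate p] (a : lp (fun _ : ℕ => 𝕜) q) :
    ‖pairing (p := p) a‖ ≤ ‖a‖ := by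
  refine (ContinuousLinearMap.le_of_opNorm_le _ (lp.norm_dualPairing _ _) a).trans ?_
  simp

/-- The operator `x ↦ (φᵢ(x))ᵢ` into `ℓ_∞` given by a family of functionals of norm at most `1`. -/
noncomputable def linftyOfFunctionals {ι : Type*} (φ : ι → StrongDual 𝕜 E) (hφ : ∀ i, ‖φ i‖ ≤ 1) :
    E →L[𝕜] lp (fun _ : ι => 𝕜) ∞ :=
  LinearMap.mkContinuous
    { toFun := fun x => ⟨fun i => φ i x, memℓp_infty ⟨1 * ‖x‖, by
        rintro _ ⟨i, rfl⟩
        exact (φ i).le_of_opNorm_le (hφ i) x⟩⟩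
      map_add' := fun x x' => by
        ext i
        exact map_add (φ i) x x'
      map_smul' := fun c x => by
        ext i
        exact map_smul (φ i) c x }
    1 fun x => lp.norm_le_of_forall_le (by positivity)
      fun i => (φ i).le_of_opNorm_le (hφ i) x

theorem norm_linftyOfFunctionals_le {ι : Type*} (φ : ι → StrongDual 𝕜 E) (hφ : ∀ i, ‖φ i‖ ≤ 1) :
    ‖linftyOfFunctionals φ hφ‖ ≤ 1 :=
  LinearMap.mkContinuous_norm_le _ zero_le_one _

/-- The operator `x ↦ (zₙ(x))ₙ` from `E` to `ℓ_p` given by a sequence `z` in `ℓ_p^s(E*)`. -/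
noncomputable def evalSeq (z : lp (fun _ : ℕ => StrongDual 𝕜 E) p) :
    E →L[𝕜] lp (fun _ : ℕ => 𝕜) p :=
  have hev (x : E) : ‖ContinuousLinearMap.apply 𝕜 𝕜 x‖ ≤ ‖x‖ :=
    ContinuousLinearMap.opNorm_le_bound _ (norm_nonneg x) fun f => by
      rw [mul_comm]
      exact f.le_opNorm x
  LinearMap.mkContinuous
    { toFun := fun x => lp.mapCLM p (fun _ : ℕ => ContinuousLinearMap.apply 𝕜 𝕜 x)
        (norm_nonneg x) (fun _ => hev x) z
      map_add' := fun x x' => by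
        ext n
        exact map_add (z n) x x'
      map_smul' := fun c x => by
        ext n
        exact map_smul (z n) c x }
    ‖z‖ fun x => by
      rw [mul_comm]
      exact ContinuousLinearMap.le_of_opNorm_le _
        (lp.norm_mapCLM_le p _ (norm_nonneg x) fun _ => hev x) z

theorem evalSeq_apply (z : lp (fun _ : ℕ => StrongDual 𝕜 E) p) (x : E) (n : ℕ) :
    evalSeq z x n = z n x :=
  rfl

theorem evalSeq_mem_strongSeq {z : lp (fun _ : ℕ => StrongDual 𝕜 E) p}
    (hz : z ∈ strongSeq (StrongDual 𝕜 E) p) (x : E) : evalSeq z x ∈ strongSeq 𝕜 p := by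
  intro hp
  have h := ((ContinuousLinearMap.apply 𝕜 𝕜 x).continuous.tendsto 0).comp (hz hp)
  rw [map_zero] at h
  exact h

/-- An operator that factors as a contraction after `evalSeq z` has an adjoint mapping the unit ball
into `E_z(B_{ℓ_q})`. -/
theorem banachAdjoint_comp_evalSeq_image_subset {F : Type*} [NormedAddCommGroup F]
    [NormedSpace 𝕜 F] [p.HolderConjugate q] {z : lp (fun _ : ℕ => StrongDual 𝕜 E) p}
    (hz : z ∈ strongSeq (StrongDual 𝕜 E) p) (A : lp (fun _ : ℕ => 𝕜) p →L[𝕜] F) (hA : ‖A‖ ≤ 1) :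
    banachAdjoint (A ∘L evalSeq z) '' Metric.closedBall 0 1 ⊆
      seqBallImage 𝕜 q (fun n => z n) := by
  rintro _ ⟨μ, hμ, rfl⟩
  have hμ1 : ‖μ‖ ≤ 1 := mem_closedBall_zero_iff.mp hμ
  have hφ : ‖μ ∘L A‖ ≤ 1 :=
    (μ.opNorm_comp_le A).trans (mul_le_one₀ hμ1 (norm_nonneg _) hA)
  refine ⟨dualCoeff (μ ∘L A) hφ, norm_dualCoeff_le _ _, ?_⟩
  have hs := (summable_smul (dualCoeff (q := q) (μ ∘L A) hφ) z).hasSum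
  -- The sum of the norm-convergent series is identified by its values at the points of `E`.
  have heq : ∑' n, dualCoeff (q := q) (μ ∘L A) hφ n • z n =
      banachAdjoint (A ∘L evalSeq z) μ := by
    ext x
    have h₁ : HasSum (fun n => dualCoeff (q := q) (μ ∘L A) hφ n * z n x)
        ((∑' n, dualCoeff (q := q) (μ ∘L A) hφ n • z n) x) :=
      hs.mapL (ContinuousLinearMap.apply 𝕜 𝕜 x)
    have h₂ : HasSum (fun n => dualCoeff (q := q) (μ ∘L A) hφ n * z n x)
        ((μ ∘L A) (evalSeq z x)) :=
      hasSum_dualCoeff (μ ∘L A) hφ (evalSeq_mem_strongSeq hz x)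
    exact h₁.unique h₂
  exact heq ▸ hs

end lp

/-! ### Extension of the operator -/

/-- Termwise norm-preserving Hahn–Banach extension of a sequence in `ℓ_p^s(X*)`. -/
theorem exists_extension_strongSeq {𝕜 : Type*} [RCLike 𝕜] {X Z : Type*}
    [NormedAddCommGroup X] [NormedSpace 𝕜 X] [NormedAddCommGroup Z] [NormedSpace 𝕜 Z]
    (j : X →ₗᵢ[𝕜] Z) {p : ℝ≥0∞} (hp : p ≠ 0) {y : lp (fun _ : ℕ => StrongDual 𝕜 X) p}
    (hy : y ∈ strongSeq (StrongDual 𝕜 X) p) :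
    ∃ z ∈ strongSeq (StrongDual 𝕜 Z) p, (∀ n x, z n (j x) = y n x) ∧ ‖z‖ ≤ ‖y‖ := by
  have hext (f : StrongDual 𝕜 X) : ∃ g : StrongDual 𝕜 Z, (∀ x, g (j x) = f x) ∧ ‖g‖ = ‖f‖ := by
    obtain ⟨g, hg, hgn⟩ := exists_extension_norm_eq (LinearMap.range j.toLinearMap)
      (f ∘L j.equivRange.symm.toContinuousLinearEquiv.toContinuousLinearMap)
    refine ⟨g, fun x => ?_, hgn.trans ?_⟩
    · have h := hg (j.equivRange x)
      simpa using h
    · exact f.opNorm_comp_linearIsometryEquiv j.equivRange.symm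
  choose g hg hgn using hext
  refine ⟨⟨fun n => g (y n), (lp.memℓp y).mono' fun n => (hgn _).le⟩, fun hp' => ?_,
    fun n x => hg _ x, lp.norm_mono hp fun n => (hgn _).le⟩
  have h := tendsto_zero_iff_norm_tendsto_zero.1 (hy hp')
  refine tendsto_zero_iff_norm_tendsto_zero.2 (h.congr fun n => ?_)
  exact (hgn _).symm

theorem theoremT4 {𝕜 : Type*} [RCLike 𝕜] {X Y Z : Type*}
    [NormedAddCommGroup X] [NormedSpace 𝕜 X] [CompleteSpace X]
    [NormedAddCommGroup Y] [NormedSpace 𝕜 Y] [CompleteSpace Y]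
    [NormedAddCommGroup Z] [NormedSpace 𝕜 Z] [CompleteSpace Z]
    (j : X →ₗᵢ[𝕜] Z) (p : ENNReal) (hp : 1 ≤ p)
    (T : X →L[𝕜] Y) (hT : IsDualPCompactOp p T) (ε : ℝ) (hε : 0 < ε) :
    ∃ T' : Z →L[𝕜] LinftyDualBall 𝕜 Y,
      (∀ x : X, T' (j x) = canonicalEmbedding 𝕜 Y (T x)) ∧
      IsDualPCompactOp p T' ∧
      kappaDual p T' ≤ kappaDual p T + ε := by
  have : Fact (1 ≤ p) := ⟨hp⟩
  have : Fact (1 ≤ p.conjExponent) := ⟨ENNReal.HolderConjugate.one_le _ p⟩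
  obtain ⟨y₀, hy₀, hTy₀⟩ := hT
  obtain ⟨_, ⟨y, hy, hTy, rfl⟩, hyε⟩ := exists_lt_of_csInf_lt
    (s := {r : ℝ | ∃ y ∈ strongSeq (StrongDual 𝕜 X) p, banachAdjoint T '' Metric.closedBall 0 1 ⊆
      seqBallImage 𝕜 p.conjExponent (fun n => y n) ∧ r = ‖y‖})
    ⟨‖y₀‖, y₀, hy₀, hTy₀, rfl⟩ (lt_add_of_pos_right (kappaDual p T) hε)
  obtain ⟨z, hz, hzy, hznorm⟩ :=
    exists_extension_strongSeq j (zero_lt_one.trans_le hp).ne' hy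
  choose a ha hasum using fun f : Metric.closedBall (0 : StrongDual 𝕜 Y) 1 =>
    hTy (Set.mem_image_of_mem (banachAdjoint T) f.2)
  have ha' (f) : ‖lp.pairing (p := p) (a f)‖ ≤ 1 := (lp.norm_pairing_le (a f)).trans (ha f)
  have hT' := lp.banachAdjoint_comp_evalSeq_image_subset (q := p.conjExponent) hz
    (lp.linftyOfFunctionals (fun f => lp.pairing (a f)) ha') (lp.norm_linftyOfFunctionals_le _ _)
  refine ⟨lp.linftyOfFunctionals (fun f => lp.pairing (a f)) ha' ∘L lp.evalSeq z,
    fun x => ?_, ⟨z, hz, hT'⟩, ?_⟩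
  · ext f
    change lp.pairing (a f) (lp.evalSeq z (j x)) = f.1 (T x)
    rw [lp.pairing_apply]
    simp only [lp.evalSeq_apply, hzy]
    exact ((ContinuousLinearMap.apply 𝕜 𝕜 x).hasSum (hasum f)).tsum_eq
  · refine le_trans (csInf_le ⟨0, ?_⟩ ⟨z, hz, hT', rfl⟩) (hznorm.trans hyε.le)
    rintro _ ⟨w, -, -, rfl⟩
    exact norm_nonneg w
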